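/- For integers $n,q\ge 0$ let $W_{n,q}$ be the set of words $w=w_1w_2\cdots w_n$ with letters in $\{1,2,\ldots,q\}$. Let $\mathrm{LIS}(w)$ (respectively $\mathrm{LDS}(w)$) be the largest $\ell$ for which there are indices $i_1<i_2<\cdots<i_\ell$ with $w_{i_1}<w_{i_2}<\cdots<w_{i_\ell}$ (respectively $w_{i_1}>w_{i_2}>\cdots>w_{i_\ell}$). An increasing tableau is a filling of a Young diagram (in English notation) with positive integers that strictly increase along rows from left to right and along columns from top to bottom. The Hecke insertion $T\leftarrow x$ of a positive integer $x$ into an increasing tableau $T$ is defined as follows. One inserts $x$ into the first row. Whenever an integer $x$ is inserted into a row $R$ (possibly empty): if $R$ contains labels strictly larger than $x$, let $y$ be the smallest of them; replace $y$ by $x$ in $R$ if the result is an increasing tableau, and otherwise change nothing; in either case insert $y$ into the next row. If $x$ is larger than or equal to all labels of $R$, adjoin a box with label $x$ at the end of $R$ if the result is an increasing tableau, and otherwise change nothing; in either case the insertion ends. For $w\in W_{n,q}$ let $\mathrm{Heckeshape}(w)$ be the shape of the increasing tableau $$P=((\cdots((\emptyset\leftarrow w_1)\leftarrow w_2)\leftarrow\cdots)\leftarrow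 w_n).$$ Theorem. For every $w\in W_{n,q}$, the first row of $\mathrm{Heckeshape}(w)$ has length $\mathrm{LIS}(w)$ and its first column has length $\mathrm{LDS}(w)$. -/

import Mathlib

namespace HeckeInsertion

/-- The set `W_{n,q}` of words `w = w₁ w₂ ⋯ wₙ` of length `n` in the alphabet `{1, 2, …, q}`. -/
abbrev Word (n q : ℕ) : Type := Fin n → Set.Icc 1 q

/-- The length of a longest strictly increasing (not necessarily consecutive) subsequence. A
subsequence is given by its set of positions. -/
def LIS {n q : ℕ} (w : Word n q) : ℕ :=
  ((Finset.univ : Finset (Finset (Fin n))).filter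
    (fun s => ∀ i ∈ s, ∀ j ∈ s, i < j → w i < w j)).sup Finset.card

/-- The length of a longest strictly decreasing (not necessarily consecutive) subsequence. -/
def LDS {n q : ℕ} (w : Word n q) : ℕ :=
  ((Finset.univ : Finset (Finset (Fin n))).filter
    (fun s => ∀ i ∈ s, ∀ j ∈ s, i < j → w j < w i)).sup Finset.card

/-- The values of `f` on the cells `s` are positive integers that strictly increase along rows
(from left to right) and along columns (from top to bottom). The cell `(i, j)` lies in row `i`
and column `j`, both counted from `0`. -/
def IsIncreasing (s : Finset (ℕ × ℕ)) (f : ℕ × ℕ → ℕ) : Prop :=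
  (∀ c ∈ s, 1 ≤ f c) ∧
  (∀ c ∈ s, ∀ d ∈ s, c.1 = d.1 → c.2 < d.2 → f c < f d) ∧
  (∀ c ∈ s, ∀ d ∈ s, c.2 = d.2 → c.1 < d.1 → f c < f d)

instance (s : Finset (ℕ × ℕ)) (f : ℕ × ℕ → ℕ) : Decidable (IsIncreasing s f) := by
  unfold IsIncreasing; infer_instance

instance (s : Finset (ℕ × ℕ)) : Decidable (IsLowerSet (s : Set (ℕ × ℕ))) :=
  decidable_of_iff (∀ c ∈ s, Finset.Iic c ⊆ s) (by
    constructor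
    · intro h a b hba ha
      exact h a ha (Finset.mem_Iic.2 hba)
    · intro h c hc d hd
      exact h (Finset.mem_Iic.1 hd) hc)

/-- An increasing tableau: a Young diagram (English notation) filled with positive integers that
strictly increase along rows and columns. As for `SemistandardYoungTableau`, the filling is
extended by `0` outside the diagram. -/
@[ext]
structure IncreasingTableau where
  /-- the shape of the tableau -/
  shape : YoungDiagram
  /-- the labels of the cells -/
  entry : ℕ × ℕ → ℕ
  increasing : IsIncreasing shape.cells entry
  zeros : ∀ c, c ∉ shape → entry c = 0

namespace IncreasingTableau

/-- The empty tableau. -/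
def empty : IncreasingTableau where
  shape := ⊥
  entry := fun _ => 0
  increasing := by simp [IsIncreasing]
  zeros := fun _ _ => rfl

/-- Replace the label of the cell `c` of `T` by `x` if this results in an increasing tableau;
otherwise leave `T` unchanged. -/
def replace (T : IncreasingTableau) (c : ℕ × ℕ) (hc : c ∈ T.shape) (x : ℕ) : IncreasingTableau :=
  if h : IsIncreasing T.shape.cells (Function.update T.entry c x) then
    { shape := T.shape
      entry := Function.update T.entry c x
      increasing := h
      zeros := fun d hd => by
        have hdc : d ≠ c := by
          rintro rfl
          exact hd hc
        rw [Function.update_of_ne hdc]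
        exact T.zeros d hd }
  else T

theorem replace_shape (T : IncreasingTableau) (c : ℕ × ℕ) (hc : c ∈ T.shape) (x : ℕ) :
    (T.replace c hc x).shape = T.shape := by
  unfold replace; split_ifs <;> rfl

/-- Adjoin a cell with label `x` at the end of row `i` of `T` if this results in an increasing
tableau (in particular, in a Young diagram); otherwise leave `T` unchanged. -/
def adjoin (T : IncreasingTableau) (i x : ℕ) : IncreasingTableau :=
  let c : ℕ × ℕ := (i, T.shape.rowLen i)
  if h : IsLowerSet ((insert c T.shape.cells : Finset (ℕ × ℕ)) : Set (ℕ × ℕ)) ∧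
      IsIncreasing (insert c T.shape.cells) (Function.update T.entry c x) then
    { shape := ⟨insert c T.shape.cells, h.1⟩
      entry := Function.update T.entry c x
      increasing := h.2
      zeros := fun d hd => by
        have hd' : d ∉ insert c T.shape.cells := fun m => hd ((YoungDiagram.mem_cells _).1 m)
        rw [Finset.mem_insert, not_or] at hd'
        rw [Function.update_of_ne hd'.1]
        exact T.zeros d (fun m => hd'.2 ((YoungDiagram.mem_cells _).2 m)) }
  else T

/-- Insert `x` into row `i` of `T`, the output integer (if any) into row `i + 1`, and so on until
no output integer is created. If row `i` has a label larger than `x`, then the smallest such label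
`y`, which is the leftmost one because the rows increase, is replaced by `x` if this results in an
increasing tableau, and in either case `y` is inserted into the next row. Otherwise `x` is
adjoined at the end of row `i` if this results in an increasing tableau, and the process stops. -/
def insertFrom (T : IncreasingTableau) (i x : ℕ) : IncreasingTableau :=
  if h : ∃ j, j < T.shape.rowLen i ∧ x < T.entry (i, j) then
    insertFrom
      (T.replace (i, Nat.find h) (YoungDiagram.mem_iff_lt_rowLen.2 (Nat.find_spec h).1) x)
      (i + 1) (T.entry (i, Nat.find h))
  else T.adjoin i x
termination_by T.shape.colLen 0 - i
decreasing_by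
  rw [replace_shape]
  have h0 : (i, 0) ∈ T.shape :=
    YoungDiagram.mem_iff_lt_rowLen.2 (lt_of_le_of_lt (Nat.zero_le _) (Nat.find_spec h).1)
  have := YoungDiagram.mem_iff_lt_colLen.1 h0
  omega

/-- The Hecke insertion `T ← x`, which starts at the first row. -/
def heckeInsert (T : IncreasingTableau) (x : ℕ) : IncreasingTableau := T.insertFrom 0 x

end IncreasingTableau

/-- The insertion tableau `P = ((∅ ← w₁) ← w₂) ← ⋯ ← wₙ` of the Hecke algorithm. -/
def insertionTableau {n q : ℕ} (w : Word n q) : IncreasingTableau :=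
  (List.ofFn (fun k => (w k : ℕ))).foldl IncreasingTableau.heckeInsert IncreasingTableau.empty

/-- The Young diagram associated to the word `w` by the Hecke algorithm. -/
def heckeShape {n q : ℕ} (w : Word n q) : YoungDiagram := (insertionTableau w).shape

end HeckeInsertion

namespace HeckeInsertion

/-! ### Domination of decreasing subsequences -/

/-! Both equalities come from invariants preserved at each insertion.

Columns. Read a tableau row by row, bottom row first. A decreasing subsequence of this word takes at
most one letter from each row, and the first column read upwards attains the number of rows. So it
suffices that the reading word of `P` and `w` have decreasing subsequences of the same maximal
length. The relation `DecEquiv` strengthens this to a congruence for concatenation: the matching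
subsequence must also stay within the range of the given one. Passing `x` through a row `R` replaces
`R ++ [x]` by `[y] ++ R'`, or by the new row if the insertion stops. By `replace_cases` and
`adjoin_cases`, a change can be blocked only by an `x` already in `R` or by an `x` directly above
the target cell. The first kind is an equivalence of the row alone (`decEquiv_bump`,
`decEquiv_absorb`). The second needs the row above as right context (`decEquiv_bump_blocked`,
`decEquiv_adjoin_blocked`). Chaining the rows gives `insertFrom_decEquiv`.

Rows. On the first row, Hecke insertion is patience sorting: `x` overwrites the first label that is
at least `x`, or is appended. Hence the label in column `m` is the least possible last letter of an
increasing subsequence of length `m + 1` (`exists_increasing_sublist_iff`). -/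

/-- Every strictly decreasing subsequence of `w` is matched by one of `w'` which is at least as
long and whose letters lie between the smallest and the largest letter of the given one. -/
def DecLE (w w' : List ℕ) : Prop :=
  ∀ l : List ℕ, l.Sublist w → l.Pairwise (· > ·) → ∃ l' : List ℕ, l'.Sublist w' ∧ l'.Pairwise (· > ·) ∧
    l.length ≤ l'.length ∧ ∀ y ∈ l', (∃ p ∈ l, p ≤ y) ∧ ∃ p ∈ l, y ≤ p

theorem DecLE.refl (w : List ℕ) : DecLE w w := fun l hl hd =>
  ⟨l, hl, hd, le_rfl, fun y hy => ⟨⟨y, hy, le_rfl⟩, y, hy, le_rfl⟩⟩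

theorem DecLE.trans {u v w : List ℕ} (h₁ : DecLE u v) (h₂ : DecLE v w) : DecLE u w := by
  intro l hl hd
  obtain ⟨l', hl', hd', hlen, hb⟩ := h₁ l hl hd
  obtain ⟨l₂, hl₂, hd₂, hlen₂, hb₂⟩ := h₂ l' hl' hd'
  refine ⟨l₂, hl₂, hd₂, hlen.trans hlen₂, fun y hy => ?_⟩
  obtain ⟨⟨p, hp, hpy⟩, r, hr, hyr⟩ := hb₂ y hy
  obtain ⟨⟨p', hp', hpp⟩, -⟩ := hb p hp
  obtain ⟨-, r', hr', hrr⟩ := hb r hr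
  exact ⟨⟨p', hp', hpp.trans hpy⟩, r', hr', hyr.trans hrr⟩

/-- The range condition makes the two matches fit: a letter matched on the left is at least some old
left letter, which exceeds some old right letter, which is at least the matched right letter. -/
theorem DecLE.append {u u' v v' : List ℕ} (h₁ : DecLE u u') (h₂ : DecLE v v') :
    DecLE (u ++ v) (u' ++ v') := by
  intro l hl hd
  obtain ⟨a, b, rfl, ha, hb⟩ := List.sublist_append_iff.1 hl
  obtain ⟨hda, hdb, hab⟩ := List.pairwise_append.1 hd
  obtain ⟨a', ha', hda', hlena, hba⟩ := h₁ a ha hda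
  obtain ⟨b', hb', hdb', hlenb, hbb⟩ := h₂ b hb hdb
  refine ⟨a' ++ b', ha'.append hb', List.pairwise_append.2 ⟨hda', hdb', fun x hx y hy => ?_⟩,
    by simp only [List.length_append]; omega, fun y hy => ?_⟩
  · obtain ⟨⟨p, hp, hpx⟩, -⟩ := hba x hx
    obtain ⟨-, r, hr, hyr⟩ := hbb y hy
    have := hab p hp r hr
    omega
  · rcases List.mem_append.1 hy with hy | hy
    · obtain ⟨⟨p, hp, h⟩, r, hr, h'⟩ := hba y hy
      exact ⟨⟨p, List.mem_append_left _ hp, h⟩, r, List.mem_append_left _ hr, h'⟩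
    · obtain ⟨⟨p, hp, h⟩, r, hr, h'⟩ := hbb y hy
      exact ⟨⟨p, List.mem_append_right _ hp, h⟩, r, List.mem_append_right _ hr, h'⟩

/-- Two words with mutually dominating decreasing subsequences. -/
def DecEquiv (w w' : List ℕ) : Prop := DecLE w w' ∧ DecLE w' w

theorem DecEquiv.refl (w : List ℕ) : DecEquiv w w := ⟨.refl w, .refl w⟩

theorem DecEquiv.trans {u v w : List ℕ} (h₁ : DecEquiv u v) (h₂ : DecEquiv v w) :
    DecEquiv u w := ⟨h₁.1.trans h₂.1, h₂.2.trans h₁.2⟩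

theorem DecEquiv.symm {u v : List ℕ} (h : DecEquiv u v) : DecEquiv v u := ⟨h.2, h.1⟩

theorem DecEquiv.append {u u' v v' : List ℕ} (h₁ : DecEquiv u u') (h₂ : DecEquiv v v') :
    DecEquiv (u ++ v) (u' ++ v') := ⟨h₁.1.append h₂.1, h₁.2.append h₂.2⟩

/-! ### Local equivalences for one row -/

/-- A decreasing subsequence of an increasing word has at most one letter. -/
theorem eq_nil_or_singleton_of_sublist {R l : List ℕ} (hR : R.Pairwise (· < ·))
    (hl : l.Sublist R) (hd : l.Pairwise (· > ·)) : l = [] ∨ ∃ r ∈ R, l = [r] := by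
  rcases l with _ | ⟨a, _ | ⟨b, l⟩⟩
  · exact .inl rfl
  · exact .inr ⟨a, hl.subset (by simp), rfl⟩
  · have h₁ := hR.sublist hl
    simp only [List.pairwise_cons, List.mem_cons, forall_eq_or_imp] at h₁ hd
    have := h₁.1.1
    have := hd.1.1
    omega

/-- Both words have decreasing subsequences of at most two letters, and every two-letter one can be
exchanged for `[y, x]`, whose range is the smallest. The hypotheses on `R'` cover both the actual
replacement and `R' = R` with `x` already present. -/
theorem decEquiv_bump {R R' : List ℕ} {x y : ℕ} (hR : R.Pairwise (· < ·))
    (hR' : R'.Pairwise (· < ·)) (hy : y ∈ R) (hxy : x < y) (hmin : ∀ r ∈ R, x < r → y ≤ r)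
    (hx : x ∈ R') (h₁ : ∀ r ∈ R', r = x ∨ r ∈ R) (h₂ : ∀ r ∈ R, r = y ∨ r ∈ R') :
    DecEquiv (R ++ [x]) ([y] ++ R') := by
  have sx : [y, x].Sublist ([y] ++ R') := (List.Sublist.refl [y]).append (List.singleton_sublist.2 hx)
  have sy : [y, x].Sublist (R ++ [x]) := (List.singleton_sublist.2 hy).append (List.Sublist.refl [x])
  constructor
  · intro l hl hd
    obtain ⟨a, b, rfl, ha, hb⟩ := List.sublist_append_iff.1 hl
    obtain ⟨hda, hdb, hab⟩ := List.pairwise_append.1 hd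
    rcases eq_nil_or_singleton_of_sublist hR ha hda with rfl | ⟨r, hr, rfl⟩ <;>
    rcases eq_nil_or_singleton_of_sublist (List.pairwise_singleton _ x) hb hdb with
      rfl | ⟨z, hz, rfl⟩
    · exact ⟨[], by simp, by simp, by simp, by simp⟩
    · obtain rfl : z = x := by simpa using hz
      exact ⟨[z], by simp [hx], by simp, by simp, by simp⟩
    · exact ⟨[r], by simpa using h₂ r hr, by simp, by simp, by simp⟩
    · obtain rfl : z = x := by simpa using hz
      have hrz : z < r := by simpa using hab
      exact ⟨[y, z], sx, by simpa using hxy, by simp, by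
        have := hmin r hr hrz
        simp; omega⟩
  · intro l hl hd
    obtain ⟨a, b, rfl, ha, hb⟩ := List.sublist_append_iff.1 hl
    obtain ⟨hda, hdb, hab⟩ := List.pairwise_append.1 hd
    rcases eq_nil_or_singleton_of_sublist hR' hb hdb with rfl | ⟨r, hr, rfl⟩ <;>
    rcases eq_nil_or_singleton_of_sublist (List.pairwise_singleton _ y) ha hda with
      rfl | ⟨z, hz, rfl⟩
    · exact ⟨[], by simp, by simp, by simp, by simp⟩
    · obtain rfl : z = y := by simpa using hz
      exact ⟨[z], by simp [hy], by simp, by simp, by simp⟩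
    · exact ⟨[r], by simpa [or_comm] using h₁ r hr, by simp, by simp, by simp⟩
    · obtain rfl : z = y := by simpa using hz
      have hrz : r < z := by simpa using hab
      refine ⟨[z, x], sy, by simpa using hxy, by simp, ?_⟩
      have : r ≤ x := by
        rcases h₁ r hr with h | h
        · exact h.le
        · by_contra hc
          have := hmin r h (by omega)
          omega
      simp; omega

/-- No letter of `R` exceeds `x`, so the appended copy starts or extends nothing that the old copy
does not already provide. -/
theorem decEquiv_absorb {R : List ℕ} {x : ℕ} (hR : R.Pairwise (· < ·)) (hx : x ∈ R)
    (hmax : ∀ r ∈ R, r ≤ x) : DecEquiv (R ++ [x]) R := by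
  refine ⟨fun l hl hd => ?_, fun l hl hd => ⟨l, hl.trans (by simp), hd, le_rfl,
    fun y hy => ⟨⟨y, hy, le_rfl⟩, y, hy, le_rfl⟩⟩⟩
  obtain ⟨a, b, rfl, ha, hb⟩ := List.sublist_append_iff.1 hl
  obtain ⟨hda, hdb, hab⟩ := List.pairwise_append.1 hd
  rcases eq_nil_or_singleton_of_sublist hR ha hda with rfl | ⟨r, hr, rfl⟩ <;>
  rcases eq_nil_or_singleton_of_sublist (List.pairwise_singleton _ x) hb hdb with
    rfl | ⟨z, hz, rfl⟩
  · exact ⟨[], by simp, by simp, by simp, by simp⟩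
  · obtain rfl : z = x := by simpa using hz
    exact ⟨[z], by simp [hx], by simp, by simp, by simp⟩
  · exact ⟨[r], by simpa using hr, by simp, by simp, by simp⟩
  · obtain rfl : z = x := by simpa using hz
    have hrz : z < r := by simpa using hab
    have := hmax r hr
    omega

/-- The letter `x` bumps `y` from the row `R`, but cannot replace it because of the label `x` in
the row `S` above. -/
theorem decEquiv_bump_blocked {R S : List ℕ} {x y : ℕ} (hR : R.Pairwise (· < ·))
    (hS : S.Pairwise (· < ·)) (hy : y ∈ R) (hxy : x < y) (hmin : ∀ r ∈ R, x < r → y ≤ r)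
    (hx : x ∈ S) (h : ∀ s ∈ S, s < x → ∃ r ∈ R, s < r ∧ r ≤ x) :
    DecEquiv (R ++ [x] ++ S) ([y] ++ R ++ S) := by
  constructor
  · intro l hl hd
    obtain ⟨ab, c, rfl, hab', hc⟩ := List.sublist_append_iff.1 hl
    obtain ⟨a, b, rfl, ha, hb⟩ := List.sublist_append_iff.1 hab'
    obtain ⟨hdab, hdc, habc⟩ := List.pairwise_append.1 hd
    obtain ⟨hda, hdb, hab⟩ := List.pairwise_append.1 hdab
    rcases eq_nil_or_singleton_of_sublist (List.pairwise_singleton _ x) hb hdb with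
      rfl | ⟨z, hz, rfl⟩
    · exact ⟨a ++ [] ++ c, (by simpa using ((ha.cons y).append hc)), hd, le_rfl,
        fun y hy => ⟨⟨y, hy, le_rfl⟩, y, hy, le_rfl⟩⟩
    · obtain rfl : z = x := by simpa using hz
      rcases eq_nil_or_singleton_of_sublist hR ha hda with rfl | ⟨r, hr, rfl⟩ <;>
      rcases eq_nil_or_singleton_of_sublist hS hc hdc with rfl | ⟨s, hs, rfl⟩
      · exact ⟨[z], by simp [hx], by simp, by simp, by simp⟩
      · have hsz : s < z := by simpa using habc
        obtain ⟨t, ht, hst, htz⟩ := h s hs hsz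
        refine ⟨[t] ++ [s], List.Sublist.append (by simp [ht]) (by simp [hs]), by simpa using hst,
          by simp, ?_⟩
        simp; omega
      · have hzr : z < r := by simpa using hab
        have := hmin r hr hzr
        refine ⟨[y] ++ [z], List.Sublist.append (by simp) (by simp [hx]), by simpa using hxy,
          by simp, ?_⟩
        simp; omega
      · have hzr : z < r := by simpa using hab
        have hsz : s < z := by
          have := habc z (by simp) s (by simp)
          omega
        have := hmin r hr hzr
        obtain ⟨t, ht, hst, htz⟩ := h s hs hsz
        -- The copy of `x` in `S` comes after `s`, so it cannot serve as the middle letter; `t` from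
        -- `R` does, and the prefixed `y` stands in for `r`.
        refine ⟨[y] ++ [t] ++ [s], ((List.Sublist.refl _).append (by simpa using ht)).append
          (by simpa using hs), ?_, by simp, ?_⟩
        · simp; omega
        · simp; omega
  · intro l hl hd
    obtain ⟨ab, c, rfl, hab', hc⟩ := List.sublist_append_iff.1 hl
    obtain ⟨a, b, rfl, ha, hb⟩ := List.sublist_append_iff.1 hab'
    obtain ⟨hdab, hdc, habc⟩ := List.pairwise_append.1 hd
    obtain ⟨hda, hdb, hab⟩ := List.pairwise_append.1 hdab
    rcases eq_nil_or_singleton_of_sublist (List.pairwise_singleton _ y) ha hda with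
      rfl | ⟨z, hz, rfl⟩
    · exact ⟨[] ++ b ++ c, List.Sublist.append (hb.trans (by simp)) hc, hd, le_rfl,
        fun y hy => ⟨⟨y, hy, le_rfl⟩, y, hy, le_rfl⟩⟩
    · obtain rfl : z = y := by simpa using hz
      rcases eq_nil_or_singleton_of_sublist hR hb hdb with rfl | ⟨r, hr, rfl⟩
      · exact ⟨[z] ++ [] ++ c, List.Sublist.append (by simp [hy]) hc, hd, le_rfl,
          fun y hy => ⟨⟨y, hy, le_rfl⟩, y, hy, le_rfl⟩⟩
      · have hrz : r < z := by simpa using hab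
        have hrx : r ≤ x := by
          by_contra hc
          have := hmin r hr (by omega)
          omega
        -- In `R` the letter `r` precedes `y`, so the pair `y > r` is traded for `y > x`, with `r ≤
        -- x` keeping it above `c`.
        refine ⟨[z] ++ [x] ++ c, List.Sublist.append (List.Sublist.append (by simp [hy]) (.refl _)) hc,
          ?_, by simp, ?_⟩
        · refine List.pairwise_append.2 ⟨by simpa using hxy, hdc, fun u hu s hs => ?_⟩
          have := habc r (by simp) s hs
          have : u = z ∨ u = x := by simpa using hu
          omega
        · intro u hu
          have : u = z ∨ u = x ∨ u ∈ c := by simpa using hu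
          rcases this with rfl | rfl | hu
          · exact ⟨⟨u, by simp, le_rfl⟩, u, by simp, le_rfl⟩
          · exact ⟨⟨r, by simp, hrx⟩, z, by simp, hxy.le⟩
          · exact ⟨⟨u, by simp [hu], le_rfl⟩, u, by simp [hu], le_rfl⟩

/-- The letter `x` cannot be adjoined to the row `R` because of the label `x` in the row `S`
above. -/
theorem decEquiv_adjoin_blocked {R S : List ℕ} {x : ℕ} (hR : R.Pairwise (· < ·))
    (hS : S.Pairwise (· < ·)) (hmax : ∀ r ∈ R, r ≤ x)
    (hx : x ∈ S) (h : ∀ s ∈ S, s < x → ∃ r ∈ R, s < r ∧ r ≤ x) :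
    DecEquiv (R ++ [x] ++ S) (R ++ S) := by
  constructor
  · intro l hl hd
    obtain ⟨ab, c, rfl, hab', hc⟩ := List.sublist_append_iff.1 hl
    obtain ⟨a, b, rfl, ha, hb⟩ := List.sublist_append_iff.1 hab'
    obtain ⟨hdab, hdc, habc⟩ := List.pairwise_append.1 hd
    obtain ⟨hda, hdb, hab⟩ := List.pairwise_append.1 hdab
    rcases eq_nil_or_singleton_of_sublist (List.pairwise_singleton _ x) hb hdb with
      rfl | ⟨z, hz, rfl⟩
    · exact ⟨a ++ [] ++ c, by simpa using ha.append hc, hd, le_rfl,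
        fun y hy => ⟨⟨y, hy, le_rfl⟩, y, hy, le_rfl⟩⟩
    · obtain rfl : z = x := by simpa using hz
      rcases eq_nil_or_singleton_of_sublist hR ha hda with rfl | ⟨r, hr, rfl⟩
      · rcases eq_nil_or_singleton_of_sublist hS hc hdc with rfl | ⟨s, hs, rfl⟩
        · exact ⟨[z], by simp [hx], by simp, by simp, by simp⟩
        · have hsz : s < z := by simpa using habc
          obtain ⟨t, ht, hst, htz⟩ := h s hs hsz
          refine ⟨[t] ++ [s], List.Sublist.append (by simp [ht]) (by simp [hs]),
            by simpa using hst, by simp, ?_⟩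
          simp; omega
      · have hzr : z < r := by simpa using hab
        have := hmax r hr
        omega
  · intro l hl hd
    exact ⟨l, hl.trans (List.Sublist.append (by simp) (.refl _)), hd, le_rfl,
      fun y hy => ⟨⟨y, hy, le_rfl⟩, y, hy, le_rfl⟩⟩

/-! ### Rows and reading words of tableaux -/

namespace IncreasingTableau

theorem entry_lt_of_row (T : IncreasingTableau) {i j k : ℕ} (hjk : j < k)
    (hk : k < T.shape.rowLen i) : T.entry (i, j) < T.entry (i, k) :=
  T.increasing.2.1 (i, j) (YoungDiagram.mem_iff_lt_rowLen.2 (hjk.trans hk)) (i, k)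
    (YoungDiagram.mem_iff_lt_rowLen.2 hk) rfl hjk

theorem entry_lt_of_col (T : IncreasingTableau) {i k j : ℕ} (hik : i < k)
    (hk : j < T.shape.rowLen k) : T.entry (i, j) < T.entry (k, j) :=
  T.increasing.2.2 (i, j)
    (T.shape.up_left_mem hik.le le_rfl (YoungDiagram.mem_iff_lt_rowLen.2 hk)) (k, j)
    (YoungDiagram.mem_iff_lt_rowLen.2 hk) rfl hik

theorem one_le_entry (T : IncreasingTableau) {i j : ℕ} (h : j < T.shape.rowLen i) :
    1 ≤ T.entry (i, j) :=
  T.increasing.1 (i, j) (YoungDiagram.mem_iff_lt_rowLen.2 h)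

/-- The labels of row `i`, from left to right. -/
def row (T : IncreasingTableau) (i : ℕ) : List ℕ :=
  (List.range (T.shape.rowLen i)).map fun j => T.entry (i, j)

theorem mem_row {T : IncreasingTableau} {i v : ℕ} :
    v ∈ T.row i ↔ ∃ j < T.shape.rowLen i, T.entry (i, j) = v := by
  simp [row]

theorem row_congr {T T' : IncreasingTableau} {i : ℕ} (hl : T.shape.rowLen i = T'.shape.rowLen i)
    (he : ∀ j, T.entry (i, j) = T'.entry (i, j)) : T.row i = T'.row i := by
  simp [row, hl, he]

theorem row_pairwise (T : IncreasingTableau) (i : ℕ) : (T.row i).Pairwise (· < ·) := by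
  rw [row, List.pairwise_map]
  exact List.pairwise_lt_range.imp_of_mem fun _ hb hab => T.entry_lt_of_row hab (List.mem_range.1 hb)

/-- The labels of the `n` rows from row `i` on, read from left to right, bottom row first. -/
def rowsFrom (T : IncreasingTableau) : ℕ → ℕ → List ℕ
  | _, 0 => []
  | i, n + 1 => rowsFrom T (i + 1) n ++ T.row i

/-- The labels of the first `i` rows, read from left to right, bottom row first. -/
def rowsBelow (T : IncreasingTableau) : ℕ → List ℕ
  | 0 => []
  | i + 1 => T.row i ++ rowsBelow T i

theorem rowsBelow_add (T : IncreasingTableau) (i n : ℕ) :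
    T.rowsBelow (i + n) = T.rowsFrom i n ++ T.rowsBelow i := by
  induction n generalizing i with
  | zero => simp [rowsFrom]
  | succ n ih =>
    rw [rowsFrom, show i + (n + 1) = i + 1 + n by omega, ih, rowsBelow, List.append_assoc]

theorem rowsFrom_congr {T T' : IncreasingTableau} {i n : ℕ} (h : ∀ k, i ≤ k → T.row k = T'.row k) :
    T.rowsFrom i n = T'.rowsFrom i n := by
  induction n generalizing i with
  | zero => rfl
  | succ n ih => rw [rowsFrom, rowsFrom, ih fun k hk => h k (by omega), h i le_rfl]

theorem rowsBelow_congr {T T' : IncreasingTableau} {i : ℕ} (h : ∀ k, k < i → T.row k = T'.row k) :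
    T.rowsBelow i = T'.rowsBelow i := by
  induction i with
  | zero => rfl
  | succ n ih => rw [rowsBelow, rowsBelow, ih fun k hk => h k (by omega), h n (by omega)]

/-! ### A single row of the insertion -/

/-- The integer `x` may arrive at row `i`: it was bumped from a cell of the row above. -/
def Admissible (T : IncreasingTableau) (i x : ℕ) : Prop :=
  1 ≤ x ∧ (0 < i → ∃ k < T.shape.rowLen (i - 1), T.entry (i - 1, k) ≤ x ∧
    (k < T.shape.rowLen i → x < T.entry (i, k)))

/-- Shows that in the columns up to `k` the only obstruction from above to a label `x` in row `i` is
an equal label directly above. -/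
theorem entry_above_le {T : IncreasingTableau} {i k j x : ℕ} (hk : k < T.shape.rowLen (i - 1))
    (hkx : T.entry (i - 1, k) ≤ x) (hjk : j ≤ k) {i' : ℕ} (hi' : i' < i) :
    T.entry (i', j) ≤ x ∧ (T.entry (i - 1, j) ≠ x → T.entry (i', j) < x) := by
  have h₁ : T.entry (i - 1, j) ≤ T.entry (i - 1, k) := by
    rcases hjk.eq_or_lt with rfl | h
    · exact le_rfl
    · exact (T.entry_lt_of_row h hk).le
  have h₂ : T.entry (i', j) ≤ T.entry (i - 1, j) := by
    rcases (Nat.le_sub_one_of_lt hi').eq_or_lt with rfl | h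
    · exact le_rfl
    · exact (T.entry_lt_of_col h (hjk.trans_lt hk)).le
  exact ⟨by omega, fun h => by omega⟩

theorem isIncreasing_replace {T : IncreasingTableau} {i j x : ℕ} (hT : T.Admissible i x)
    (hj : j < T.shape.rowLen i) (hxj : x < T.entry (i, j)) (hmin : ∀ m < j, T.entry (i, m) ≤ x)
    (hx : x ∉ T.row i) (habove : 0 < i → T.entry (i - 1, j) ≠ x) :
    IsIncreasing T.shape.cells (Function.update T.entry (i, j) x) := by
  have hup : ∀ i' < i, T.entry (i', j) < x := by
    intro i' hi'
    obtain ⟨k, hk, hkx, hk'⟩ := hT.2 (by omega)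
    -- Bumped letters move weakly left: for `k < j` the label in column `k` of row `i` would be both
    -- at most and greater than `x`.
    have hjk : j ≤ k := by
      by_contra hc
      have := hmin k (by omega)
      have := hk' (by omega)
      omega
    exact (entry_above_le hk hkx hjk hi').2 (habove (by omega))
  refine ⟨fun c hc => ?_, ?_, ?_⟩
  · rw [Function.update_apply]
    split_ifs
    · exact hT.1
    · exact T.increasing.1 c hc
  · rintro ⟨a, b⟩ hc ⟨a', b'⟩ hd (rfl : a = a') (hlt : b < b')
    rw [YoungDiagram.mem_cells, YoungDiagram.mem_iff_lt_rowLen] at hc hd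
    have hb := T.entry_lt_of_row hlt hd
    rw [Function.update_apply, Function.update_apply]
    simp only [Prod.mk.injEq]
    split_ifs with h₁ h₂ h₂
    · omega
    · obtain ⟨rfl, rfl⟩ := h₁
      omega
    · obtain ⟨rfl, rfl⟩ := h₂
      have h₃ := hmin b hlt
      have : T.entry (a, b) ≠ x := fun h => hx (mem_row.2 ⟨b, hc, h⟩)
      omega
    · exact hb
  · rintro ⟨a, b⟩ hc ⟨a', b'⟩ hd (rfl : b = b') (hlt : a < a')
    rw [YoungDiagram.mem_cells, YoungDiagram.mem_iff_lt_rowLen] at hc hd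
    have hb := T.entry_lt_of_col hlt hd
    rw [Function.update_apply, Function.update_apply]
    simp only [Prod.mk.injEq]
    split_ifs with h₁ h₂ h₂
    · omega
    · obtain ⟨rfl, rfl⟩ := h₁
      omega
    · obtain ⟨rfl, rfl⟩ := h₂
      exact hup a hlt
    · exact hb

theorem replace_cases {T : IncreasingTableau} {i j x : ℕ} (hT : T.Admissible i x)
    (hj : j < T.shape.rowLen i) (hc : (i, j) ∈ T.shape) (hxj : x < T.entry (i, j))
    (hmin : ∀ m < j, T.entry (i, m) ≤ x) :
    (x ∉ T.row i ∧ (T.replace (i, j) hc x).entry = Function.update T.entry (i, j) x) ∨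
    (T.replace (i, j) hc x = T ∧ (x ∈ T.row i ∨ 0 < i ∧ T.entry (i - 1, j) = x)) := by
  by_cases h : IsIncreasing T.shape.cells (Function.update T.entry (i, j) x)
  · refine .inl ⟨fun hx => ?_, by simp [replace, h]⟩
    obtain ⟨m, hm, hmx⟩ := mem_row.1 hx
    have hmj : m < j := by
      by_contra hc'
      rcases (not_lt.1 hc').eq_or_lt with rfl | h'
      · omega
      · have := T.entry_lt_of_row h' hm
        omega
    have := h.2.1 (i, m) (YoungDiagram.mem_iff_lt_rowLen.2 hm) (i, j) hc rfl hmj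
    simp [hmj.ne, hmx] at this
  · refine .inr ⟨by simp [replace, h], ?_⟩
    by_contra hn
    push Not at hn
    exact h (isIncreasing_replace hT hj hxj hmin hn.1 hn.2)

theorem replace_row_of_ne (T : IncreasingTableau) {i j k x : ℕ} (hc : (i, j) ∈ T.shape)
    (hk : k ≠ i) : (T.replace (i, j) hc x).row k = T.row k := by
  refine row_congr (by rw [replace_shape]) fun m => ?_
  unfold replace
  split_ifs
  · simp [hk]
  · rfl

/-- The column `k` from which `x` was bumped lies weakly right of the end of row `i`, so all cells
above the new one are present. -/
theorem isLowerSet_insert {T : IncreasingTableau} {i x : ℕ} (hT : T.Admissible i x)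
    (hmax : ∀ m < T.shape.rowLen i, T.entry (i, m) ≤ x) :
    IsLowerSet ((insert (i, T.shape.rowLen i) T.shape.cells : Finset (ℕ × ℕ)) : Set (ℕ × ℕ)) := by
  rintro ⟨a, b⟩ ⟨a', b'⟩ hle hab
  obtain ⟨ha : a' ≤ a, hb : b' ≤ b⟩ := hle
  simp only [Finset.coe_insert, Set.mem_insert_iff, Prod.mk.injEq, Finset.mem_coe,
    YoungDiagram.mem_cells] at hab ⊢
  rcases hab with ⟨rfl, rfl⟩ | hab
  · rcases ha.eq_or_lt with rfl | ha
    · rw [YoungDiagram.mem_iff_lt_rowLen]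
      omega
    · right
      obtain ⟨k, hk, -, hk'⟩ := hT.2 (by omega)
      have hjk : T.shape.rowLen a ≤ k := by
        by_contra hc
        have := hmax k (by omega)
        have := hk' (by omega)
        omega
      exact T.shape.up_left_mem (Nat.le_sub_one_of_lt ha) (hb.trans hjk)
        (YoungDiagram.mem_iff_lt_rowLen.2 hk)
  · exact .inr (T.shape.up_left_mem ha hb hab)

theorem isIncreasing_adjoin {T : IncreasingTableau} {i x : ℕ} (hT : T.Admissible i x)
    (hmax : ∀ m < T.shape.rowLen i, T.entry (i, m) ≤ x) (hx : x ∉ T.row i)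
    (habove : 0 < i → T.entry (i - 1, T.shape.rowLen i) ≠ x) :
    IsIncreasing (insert (i, T.shape.rowLen i) T.shape.cells)
      (Function.update T.entry (i, T.shape.rowLen i) x) := by
  have hup : ∀ i' < i, T.entry (i', T.shape.rowLen i) < x := by
    intro i' hi'
    obtain ⟨k, hk, hkx, hk'⟩ := hT.2 (by omega)
    have hjk : T.shape.rowLen i ≤ k := by
      by_contra hc
      have := hmax k (by omega)
      have := hk' (by omega)
      omega
    exact (entry_above_le hk hkx hjk hi').2 (habove (by omega))
  refine ⟨fun c hc => ?_, ?_, ?_⟩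
  · rw [Function.update_apply]
    split_ifs with h
    · exact hT.1
    · exact T.increasing.1 c ((Finset.mem_insert.1 hc).resolve_left h)
  · rintro ⟨a, b⟩ hc ⟨a', b'⟩ hd (rfl : a = a') (hlt : b < b')
    simp only [Finset.mem_insert, Prod.mk.injEq, YoungDiagram.mem_cells,
      YoungDiagram.mem_iff_lt_rowLen] at hc hd
    rw [Function.update_apply, Function.update_apply]
    simp only [Prod.mk.injEq]
    split_ifs with h₁ h₂ h₂
    · omega
    · obtain ⟨rfl, rfl⟩ := h₁
      omega
    · obtain ⟨rfl, rfl⟩ := h₂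
      have h₃ := hmax b hlt
      have : T.entry (a, b) ≠ x := fun h => hx (mem_row.2 ⟨b, hlt, h⟩)
      omega
    · exact T.entry_lt_of_row hlt (hd.resolve_left h₂)
  · rintro ⟨a, b⟩ hc ⟨a', b'⟩ hd (rfl : b = b') (hlt : a < a')
    simp only [Finset.mem_insert, Prod.mk.injEq, YoungDiagram.mem_cells,
      YoungDiagram.mem_iff_lt_rowLen] at hc hd
    rw [Function.update_apply, Function.update_apply]
    simp only [Prod.mk.injEq]
    split_ifs with h₁ h₂ h₂
    · omega
    · obtain ⟨rfl, rfl⟩ := h₁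
      -- No cell lies below the new one, since lower rows are not longer than row `i`.
      have hd' := hd.resolve_left h₂
      have := T.shape.rowLen_anti _ _ hlt.le
      omega
    · obtain ⟨rfl, rfl⟩ := h₂
      exact hup a hlt
    · exact T.entry_lt_of_col hlt (hd.resolve_left h₂)

theorem adjoin_cases {T : IncreasingTableau} {i x : ℕ} (hT : T.Admissible i x)
    (hmax : ∀ m < T.shape.rowLen i, T.entry (i, m) ≤ x) :
    (x ∉ T.row i ∧ (T.adjoin i x).shape.cells = insert (i, T.shape.rowLen i) T.shape.cells ∧
      (T.adjoin i x).entry = Function.update T.entry (i, T.shape.rowLen i) x) ∨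
    (T.adjoin i x = T ∧ (x ∈ T.row i ∨ 0 < i ∧ T.entry (i - 1, T.shape.rowLen i) = x)) := by
  by_cases h : IsIncreasing (insert (i, T.shape.rowLen i) T.shape.cells)
      (Function.update T.entry (i, T.shape.rowLen i) x)
  · have h' := isLowerSet_insert hT hmax
    refine .inl ⟨fun hx => ?_, by unfold adjoin; rw [dif_pos ⟨h', h⟩],
      by unfold adjoin; rw [dif_pos ⟨h', h⟩]⟩
    obtain ⟨m, hm, hmx⟩ := mem_row.1 hx
    have := h.2.1 (i, m) (Finset.mem_insert_of_mem (YoungDiagram.mem_iff_lt_rowLen.2 hm))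
      (i, T.shape.rowLen i) (Finset.mem_insert_self _ _) rfl hm
    simp [hm.ne, hmx] at this
  · refine .inr ⟨by unfold adjoin; rw [dif_neg fun h' => h h'.2], ?_⟩
    by_contra hn
    push Not at hn
    exact h (isIncreasing_adjoin hT hmax hn.1 hn.2)

theorem rowLen_of_cells {μ ν : YoungDiagram} {i k : ℕ}
    (h : ν.cells = insert (i, μ.rowLen i) μ.cells) :
    ν.rowLen k = if k = i then μ.rowLen k + 1 else μ.rowLen k := by
  refine eq_of_forall_lt_iff fun j => ?_
  rw [← YoungDiagram.mem_iff_lt_rowLen, ← YoungDiagram.mem_cells, h, Finset.mem_insert,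
    YoungDiagram.mem_cells, YoungDiagram.mem_iff_lt_rowLen, Prod.mk.injEq]
  split_ifs with hk
  · subst hk
    omega
  · omega

theorem adjoin_row_of_ne {T : IncreasingTableau} {i k x : ℕ} (hk : k ≠ i) :
    (T.adjoin i x).row k = T.row k := by
  by_cases h : IsLowerSet ((insert (i, T.shape.rowLen i) T.shape.cells : Finset (ℕ × ℕ)) :
      Set (ℕ × ℕ)) ∧ IsIncreasing (insert (i, T.shape.rowLen i) T.shape.cells)
      (Function.update T.entry (i, T.shape.rowLen i) x)
  · have hs : (T.adjoin i x).shape.cells = insert (i, T.shape.rowLen i) T.shape.cells := by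
      unfold adjoin; rw [dif_pos h]
    have he : (T.adjoin i x).entry = Function.update T.entry (i, T.shape.rowLen i) x := by
      unfold adjoin; rw [dif_pos h]
    refine row_congr ?_ fun m => ?_
    · rw [rowLen_of_cells hs, if_neg hk]
    · rw [he]
      simp [hk]
  · unfold adjoin; rw [dif_neg h]

theorem adjoin_row_self {T : IncreasingTableau} {i x : ℕ}
    (hs : (T.adjoin i x).shape.cells = insert (i, T.shape.rowLen i) T.shape.cells)
    (he : (T.adjoin i x).entry = Function.update T.entry (i, T.shape.rowLen i) x) :
    (T.adjoin i x).row i = T.row i ++ [x] := by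
  rw [row, rowLen_of_cells hs, if_pos rfl, List.range_succ, List.map_append, he, row]
  congr 1
  · refine List.map_congr_left fun m hm => ?_
    have := (List.mem_range.1 hm).ne
    simp [this]
  · simp

theorem insertFrom_of_exists {T : IncreasingTableau} {i x : ℕ}
    (h : ∃ j, j < T.shape.rowLen i ∧ x < T.entry (i, j)) :
    ∃ (j : ℕ) (hc : (i, j) ∈ T.shape), j < T.shape.rowLen i ∧ x < T.entry (i, j) ∧
      (∀ m < j, T.entry (i, m) ≤ x) ∧
      T.insertFrom i x = (T.replace (i, j) hc x).insertFrom (i + 1) (T.entry (i, j)) := by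
  have hj := (Nat.find_spec h).1
  refine ⟨Nat.find h, YoungDiagram.mem_iff_lt_rowLen.2 hj, hj, (Nat.find_spec h).2,
    fun m hm => ?_, by rw [insertFrom, dif_pos h]⟩
  have := Nat.find_min h hm
  by_contra
  omega

theorem insertFrom_of_forall {T : IncreasingTableau} {i x : ℕ}
    (h : ∀ j < T.shape.rowLen i, T.entry (i, j) ≤ x) : T.insertFrom i x = T.adjoin i x := by
  rw [insertFrom, dif_neg (by push Not; exact h)]

/-! ### The reading word is equivalent to the inserted word -/

theorem adjoin_decEquiv {T : IncreasingTableau} {i x : ℕ} (hT : T.Admissible i x)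
    (hmax : ∀ m < T.shape.rowLen i, T.entry (i, m) ≤ x) :
    DecEquiv ((T.adjoin i x).row i ++ T.rowsBelow i) (T.row i ++ [x] ++ T.rowsBelow i) := by
  have hmax' : ∀ r ∈ T.row i, r ≤ x := by
    intro r hr
    obtain ⟨m, hm, rfl⟩ := mem_row.1 hr
    exact hmax m hm
  rcases adjoin_cases hT hmax with ⟨-, hs, he⟩ | ⟨heq, hx | ⟨hi, hx⟩⟩
  · rw [adjoin_row_self hs he]
    exact .refl _
  · rw [heq]
    exact (decEquiv_absorb (T.row_pairwise i) hx hmax').symm.append (.refl _)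
  · rw [heq]
    obtain ⟨i, rfl⟩ : ∃ k, i = k + 1 := ⟨i - 1, by omega⟩
    rw [Nat.add_sub_cancel] at hx
    obtain ⟨k, hk, -, hk'⟩ := hT.2 hi
    rw [Nat.add_sub_cancel] at hk
    -- The blocking label must sit in a genuine cell of the row above; the bumping column `k`
    -- guarantees one.
    have hlen : T.shape.rowLen (i + 1) < T.shape.rowLen i := by
      by_contra hc
      have h₁ := hmax k (by omega)
      have h₂ := hk' (by omega)
      omega
    have key := decEquiv_adjoin_blocked (T.row_pairwise (i + 1)) (T.row_pairwise i) hmax'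
      (mem_row.2 ⟨_, hlen, hx⟩) (by
        -- A label `s < x` of the row above lies left of the blocking cell; the label directly
        -- beneath it is the required intermediate one.
        intro s hs hsx
        obtain ⟨m, hm, rfl⟩ := mem_row.1 hs
        have hml : m < T.shape.rowLen (i + 1) := by
          by_contra hc
          rcases (not_lt.1 hc).eq_or_lt with h | h
          · rw [h] at hx
            omega
          · have := T.entry_lt_of_row h hm
            omega
        exact ⟨_, mem_row.2 ⟨m, hml, rfl⟩, T.entry_lt_of_col (Nat.lt_succ_self i) hml, hmax m hml⟩)
    have := key.symm.append (.refl (T.rowsBelow i))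
    simpa [rowsBelow] using this

theorem replace_decEquiv {T : IncreasingTableau} {i j x : ℕ} (hT : T.Admissible i x)
    (hj : j < T.shape.rowLen i) (hc : (i, j) ∈ T.shape) (hxj : x < T.entry (i, j))
    (hmin : ∀ m < j, T.entry (i, m) ≤ x) :
    DecEquiv ([T.entry (i, j)] ++ (T.replace (i, j) hc x).row i ++ T.rowsBelow i)
      (T.row i ++ [x] ++ T.rowsBelow i) := by
  have hmin' : ∀ r ∈ T.row i, x < r → T.entry (i, j) ≤ r := by
    intro r hr hxr
    obtain ⟨m, hm, rfl⟩ := mem_row.1 hr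
    rcases lt_trichotomy m j with h | rfl | h
    · have := hmin m h
      omega
    · exact le_rfl
    · exact (T.entry_lt_of_row h hm).le
  have hy : T.entry (i, j) ∈ T.row i := mem_row.2 ⟨j, hj, rfl⟩
  rcases replace_cases hT hj hc hxj hmin with ⟨-, he⟩ | ⟨heq, hx | ⟨hi, hx⟩⟩
  · refine (decEquiv_bump (T.row_pairwise i) (row_pairwise _ i) hy hxj hmin' ?_ ?_ ?_).symm.append
      (.refl _)
    · exact mem_row.2 ⟨j, by rwa [replace_shape], by rw [he]; simp⟩
    · intro r hr
      obtain ⟨m, hm, rfl⟩ := mem_row.1 hr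
      rw [replace_shape] at hm
      rw [he, Function.update_apply]
      split_ifs with h
      · exact .inl rfl
      · exact .inr (mem_row.2 ⟨m, hm, rfl⟩)
    · intro r hr
      obtain ⟨m, hm, rfl⟩ := mem_row.1 hr
      by_cases h : m = j
      · exact .inl (by rw [h])
      · exact .inr (mem_row.2 ⟨m, by rwa [replace_shape], by
          rw [he, Function.update_of_ne (by simpa using h)]⟩)
  · rw [heq]
    exact (decEquiv_bump (T.row_pairwise i) (T.row_pairwise i) hy hxj hmin' hx
      (fun r hr => .inr hr) fun r hr => .inr hr).symm.append (.refl _)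
  · rw [heq]
    obtain ⟨i, rfl⟩ : ∃ k, i = k + 1 := ⟨i - 1, by omega⟩
    rw [Nat.add_sub_cancel] at hx
    have hlen : j < T.shape.rowLen i := hj.trans_le (T.shape.rowLen_anti _ _ (Nat.le_succ i))
    have key := decEquiv_bump_blocked (T.row_pairwise (i + 1)) (T.row_pairwise i) hy hxj hmin'
      (mem_row.2 ⟨_, hlen, hx⟩) (by
        intro s hs hsx
        obtain ⟨m, hm, rfl⟩ := mem_row.1 hs
        have hml : m < j := by
          by_contra hc
          rcases (not_lt.1 hc).eq_or_lt with h | h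
          · rw [h] at hx
            omega
          · have := T.entry_lt_of_row h hm
            omega
        exact ⟨_, mem_row.2 ⟨m, hml.trans hj, rfl⟩,
          T.entry_lt_of_col (Nat.lt_succ_self i) (hml.trans hj), hmin m hml⟩)
    have := key.symm.append (.refl (T.rowsBelow i))
    simpa [rowsBelow] using this

theorem admissible_replace {T : IncreasingTableau} {i j x : ℕ}
    (hj : j < T.shape.rowLen i) (hc : (i, j) ∈ T.shape) (hxj : x < T.entry (i, j)) :
    (T.replace (i, j) hc x).Admissible (i + 1) (T.entry (i, j)) := by
  refine ⟨T.one_le_entry hj, fun _ => ⟨j, by rwa [replace_shape], ?_, fun h => ?_⟩⟩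
  · unfold replace
    split_ifs
    · simpa using hxj.le
    · exact le_rfl
  · rw [replace_shape] at h
    have := T.entry_lt_of_col (Nat.lt_succ_self i) h
    unfold replace
    split_ifs
    · simpa [Function.update_apply] using this
    · exact this

/-- Induction on the number `n` of rows still to be visited: each row hands its output to the left,
towards the rows below it in the tableau. The strict bound leaves room for a new bottom row. -/
theorem insertFrom_decEquiv (T : IncreasingTableau) (i x n : ℕ) (hT : T.Admissible i x)
    (hn : T.shape.colLen 0 < i + n) (hn₀ : 0 < n) :
    DecEquiv ((T.insertFrom i x).rowsBelow (i + n))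
      (T.rowsFrom i n ++ [x] ++ T.rowsBelow i) := by
  obtain ⟨n, rfl⟩ : ∃ k, n = k + 1 := ⟨n - 1, by omega⟩
  induction n generalizing T i x with
  | zero =>
    -- Here `i` is at least the number of rows, so row `i` is empty.
    have h : ¬ ∃ j, j < T.shape.rowLen i ∧ x < T.entry (i, j) := by
      rintro ⟨j, hj, -⟩
      have := YoungDiagram.mem_iff_lt_colLen.1
        (YoungDiagram.mem_iff_lt_rowLen.2 ((Nat.zero_le j).trans_lt hj))
      omega
    push Not at h
    rw [insertFrom_of_forall h, rowsBelow_add,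
      rowsBelow_congr fun k hk => adjoin_row_of_ne (x := x) hk.ne]
    simpa [rowsFrom] using adjoin_decEquiv hT h
  | succ n ih =>
    by_cases h : ∃ j, j < T.shape.rowLen i ∧ x < T.entry (i, j)
    · obtain ⟨j, hc, hj, hxj, hmin, heq'⟩ := insertFrom_of_exists h
      rw [heq']
      have key := ih (T.replace (i, j) hc x) (i + 1) (T.entry (i, j))
        (admissible_replace hj hc hxj) (by rw [replace_shape]; omega) (by omega)
      rw [show i + 1 + (n + 1) = i + (n + 1 + 1) by omega, rowsBelow,
        rowsBelow_congr fun k hk => T.replace_row_of_ne hc hk.ne,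
        rowsFrom_congr fun k hk => T.replace_row_of_ne hc (by omega : k ≠ i)] at key
      refine key.trans ?_
      have := (DecEquiv.refl (T.rowsFrom (i + 1) (n + 1))).append
        (replace_decEquiv hT hj hc hxj hmin)
      rw [show T.rowsFrom i (n + 1 + 1) = T.rowsFrom (i + 1) (n + 1) ++ T.row i from rfl]
      simpa only [List.append_assoc] using this
    · push Not at h
      rw [insertFrom_of_forall h, rowsBelow_add, rowsBelow_congr fun k hk => adjoin_row_of_ne (x := x) hk.ne, rowsFrom,
        rowsFrom_congr fun k hk => adjoin_row_of_ne (by omega : k ≠ i), rowsFrom.eq_def T i]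
      simpa only [List.append_assoc] using
        (DecEquiv.refl (T.rowsFrom (i + 1) (n + 1))).append (adjoin_decEquiv hT h)

theorem exists_foldl_decEquiv (w : List ℕ) (hw : ∀ x ∈ w, 1 ≤ x) :
    ∃ N, ∀ n ≥ N, DecEquiv ((w.foldl heckeInsert empty).rowsBelow n) w := by
  induction w using List.reverseRecOn with
  | nil =>
    refine ⟨0, fun n _ => ?_⟩
    have : ∀ n, empty.rowsBelow n = [] := by
      intro n
      induction n with
      | zero => rfl
      | succ n ih =>
        have h0 : empty.shape.rowLen n = 0 := by
          by_contra h
          have := YoungDiagram.mem_iff_lt_rowLen.2 (Nat.pos_of_ne_zero h)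
          simp [empty] at this
        simp [rowsBelow, ih, row, h0]
    simpa [this n] using DecEquiv.refl []
  | append_singleton w x ih =>
    obtain ⟨N, hN⟩ := ih fun z hz => hw z (by simp [hz])
    rw [List.foldl_append]
    set T := w.foldl heckeInsert empty with hTdef
    refine ⟨max N (T.shape.colLen 0 + 1), fun n hn => ?_⟩
    have h₁ := T.insertFrom_decEquiv 0 x n ⟨hw x (by simp), by simp⟩ (by omega) (by omega)
    have h₂ := T.rowsBelow_add 0 n
    simp only [Nat.zero_add, rowsBelow, List.append_nil] at h₁ h₂
    rw [← h₂] at h₁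
    exact h₁.trans ((hN n (by omega)).append (.refl _))

/-! ### Decreasing subsequences of reading words -/

theorem length_le_of_sublist_rowsBelow (T : IncreasingTableau) {n : ℕ} {l : List ℕ}
    (hl : l.Sublist (T.rowsBelow n)) (hd : l.Pairwise (· > ·)) :
    l.length ≤ T.shape.colLen 0 := by
  -- The bound by `n` feeds the induction: a letter taken from row `n` shows that there are more
  -- than `n` rows.
  suffices h : l.length ≤ n ∧ l.length ≤ T.shape.colLen 0 from h.2
  induction n generalizing l with
  | zero => simp [List.sublist_nil.1 hl]
  | succ n ih =>
    obtain ⟨a, b, rfl, ha, hb⟩ := List.sublist_append_iff.1 hl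
    obtain ⟨hda, hdb, -⟩ := List.pairwise_append.1 hd
    have h := ih hb hdb
    rcases eq_nil_or_singleton_of_sublist (T.row_pairwise n) ha hda with rfl | ⟨r, hr, rfl⟩
    · simp only [List.nil_append]
      omega
    · obtain ⟨m, hm, -⟩ := mem_row.1 hr
      have := YoungDiagram.mem_iff_lt_colLen.1
        (YoungDiagram.mem_iff_lt_rowLen.2 ((Nat.zero_le m).trans_lt hm))
      simp only [List.length_append, List.length_singleton]
      omega

theorem exists_sublist_rowsBelow (T : IncreasingTableau) {n : ℕ} (hn : T.shape.colLen 0 ≤ n) :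
    ∃ l : List ℕ, l.Sublist (T.rowsBelow n) ∧ l.Pairwise (· > ·) ∧
      l.length = T.shape.colLen 0 := by
  have key : ∀ n ≤ T.shape.colLen 0, ∃ l : List ℕ, l.Sublist (T.rowsBelow n) ∧
      l.Pairwise (· > ·) ∧ l.length = n ∧ ∀ v ∈ l, ∃ k < n, v = T.entry (k, 0) := by
    intro n
    induction n with
    | zero => exact fun _ => ⟨[], by simp, by simp, by simp, by simp⟩
    | succ n ih =>
      intro hn
      obtain ⟨l, hl, hd, hlen, hv⟩ := ih (by omega)
      have hpos : 0 < T.shape.rowLen n := YoungDiagram.mem_iff_lt_rowLen.1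
        (YoungDiagram.mem_iff_lt_colLen.2 (by omega))
      refine ⟨[T.entry (n, 0)] ++ l, List.Sublist.append
        (List.singleton_sublist.2 (mem_row.2 ⟨0, hpos, rfl⟩)) hl, ?_, by simp [hlen], ?_⟩
      · refine List.pairwise_append.2 ⟨by simp, hd, fun a ha b hb => ?_⟩
        obtain rfl : a = _ := by simpa using ha
        obtain ⟨k, hk, rfl⟩ := hv b hb
        exact T.entry_lt_of_col hk hpos
      · intro v hv'
        rcases List.mem_append.1 hv' with h | h
        · exact ⟨n, by omega, by simpa using h⟩
        · obtain ⟨k, hk, rfl⟩ := hv v h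
          exact ⟨k, by omega, rfl⟩
  obtain ⟨l, hl, hd, hlen, -⟩ := key _ le_rfl
  refine ⟨l, hl.trans ?_, hd, hlen⟩
  obtain ⟨m, rfl⟩ := Nat.exists_eq_add_of_le hn
  rw [rowsBelow_add]
  exact List.sublist_append_right _ _

/-! ### The first row -/

theorem insertFrom_row_of_lt (T : IncreasingTableau) (i x k : ℕ) (hk : k < i) :
    (T.insertFrom i x).row k = T.row k := by
  fun_induction insertFrom T i x with
  | case1 T i x h ih => rw [ih (by omega), replace_row_of_ne _ _ hk.ne]
  | case2 T i x h => exact adjoin_row_of_ne hk.ne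

theorem rowLen_eq_of_row_eq {T T' : IncreasingTableau} {i : ℕ} (h : T.row i = T'.row i) :
    T.shape.rowLen i = T'.shape.rowLen i := by
  simpa [row] using congrArg List.length h

theorem entry_eq_of_row_eq {T T' : IncreasingTableau} {i j : ℕ} (h : T.row i = T'.row i) :
    T.entry (i, j) = T'.entry (i, j) := by
  have hl := rowLen_eq_of_row_eq h
  by_cases hj : j < T.shape.rowLen i
  · have := congrArg (fun l => l[j]?) h
    simpa [row, hj, hl ▸ hj] using this
  · rw [T.zeros _ (by rwa [YoungDiagram.mem_iff_lt_rowLen]),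
      T'.zeros _ (by rwa [YoungDiagram.mem_iff_lt_rowLen, ← hl])]

/-- The effect of Hecke insertion on the first row: `x` takes the place of the first label that
is at least `x`, or is adjoined at the end. -/
theorem heckeInsert_first_row (T : IncreasingTableau) {x : ℕ} (hx : 1 ≤ x) :
    ∃ p ≤ T.shape.rowLen 0, (∀ m < p, T.entry (0, m) < x) ∧
      (∀ m, p ≤ m → m < T.shape.rowLen 0 → x ≤ T.entry (0, m)) ∧
      (∀ m, m < (T.heckeInsert x).shape.rowLen 0 ↔ m < T.shape.rowLen 0 ∨ m = p) ∧
      ∀ m, (T.heckeInsert x).entry (0, m) = if m = p then x else T.entry (0, m) := by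
  have hT : T.Admissible 0 x := ⟨hx, by simp⟩
  -- If `x` is already present the row does not change, and `p` is the column of `x`, which is
  -- "overwritten" by itself.
  have hmem : x ∈ T.row 0 → ∀ T' : IncreasingTableau, T'.row 0 = T.row 0 →
      ∃ p ≤ T.shape.rowLen 0, (∀ m < p, T.entry (0, m) < x) ∧
      (∀ m, p ≤ m → m < T.shape.rowLen 0 → x ≤ T.entry (0, m)) ∧
      (∀ m, m < T'.shape.rowLen 0 ↔ m < T.shape.rowLen 0 ∨ m = p) ∧
      ∀ m, T'.entry (0, m) = if m = p then x else T.entry (0, m) := by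
    intro hx T' h
    obtain ⟨p, hp, rfl⟩ := mem_row.1 hx
    refine ⟨p, hp.le, fun m hm => T.entry_lt_of_row hm hp, fun m hpm hm => ?_, fun m => ?_,
      fun m => ?_⟩
    · rcases hpm.eq_or_lt with rfl | h
      · exact le_rfl
      · exact (T.entry_lt_of_row h hm).le
    · rw [rowLen_eq_of_row_eq h]
      omega
    · rw [entry_eq_of_row_eq h]
      split_ifs with hmp
      · rw [hmp]
      · rfl
  rw [heckeInsert]
  by_cases h : ∃ j, j < T.shape.rowLen 0 ∧ x < T.entry (0, j)
  · obtain ⟨j, hc, hj, hxj, hmin, heq'⟩ := insertFrom_of_exists h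
    rw [heq']
    have hrow := (T.replace (0, j) hc x).insertFrom_row_of_lt (0 + 1) (T.entry (0, j)) 0 (by omega)
    rcases replace_cases hT hj hc hxj hmin with ⟨hn, he⟩ | ⟨heq, hx | ⟨hi, -⟩⟩
    · refine ⟨j, hj.le, fun m hm => ?_, fun m hjm hm => ?_, fun m => ?_, fun m => ?_⟩
      · exact (hmin m hm).lt_of_ne fun h => hn (mem_row.2 ⟨m, hm.trans hj, h⟩)
      · rcases hjm.eq_or_lt with rfl | h
        · exact hxj.le
        · have := T.entry_lt_of_row h hm
          omega
      · rw [rowLen_eq_of_row_eq hrow, replace_shape]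
        omega
      · rw [entry_eq_of_row_eq hrow, he, Function.update_apply]
        simp
    · exact hmem hx _ (by rw [hrow, heq])
    · omega
  · push Not at h
    rw [insertFrom_of_forall h]
    rcases adjoin_cases hT h with ⟨hn, hs, he⟩ | ⟨heq, hx | ⟨hi, -⟩⟩
    · refine ⟨T.shape.rowLen 0, le_rfl, fun m hm => ?_, fun m hjm hm => by omega, fun m => ?_,
        fun m => ?_⟩
      · exact (h m hm).lt_of_ne fun h => hn (mem_row.2 ⟨m, hm, h⟩)
      · rw [rowLen_of_cells hs, if_pos rfl]
        omega
      · rw [he, Function.update_apply]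
        simp
    · exact hmem hx _ (by rw [heq])
    · omega

/-- The patience sorting invariant. Quantifying over all bounds `v` encodes "least possible last
letter" without a minimum. -/
theorem exists_increasing_sublist_iff (w : List ℕ) (hw : ∀ x ∈ w, 1 ≤ x) (m v : ℕ) :
    (∃ l : List ℕ, l.Sublist w ∧ l.Pairwise (· < ·) ∧ l.length = m + 1 ∧ ∀ z ∈ l, z ≤ v) ↔
      m < (w.foldl heckeInsert empty).shape.rowLen 0 ∧
        (w.foldl heckeInsert empty).entry (0, m) ≤ v := by
  induction w using List.reverseRecOn generalizing m v with
  | nil =>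
    have h0 : empty.shape.rowLen 0 = 0 := by
      by_contra h
      have := YoungDiagram.mem_iff_lt_rowLen.2 (Nat.pos_of_ne_zero h)
      simp [empty] at this
    constructor
    · rintro ⟨l, hl, -, hlen, -⟩
      rw [List.sublist_nil.1 hl] at hlen
      simp at hlen
    · rintro ⟨h, -⟩
      rw [List.foldl_nil, h0] at h
      omega
  | append_singleton w x ih =>
    replace ih := ih fun z hz => hw z (by simp [hz])
    have hx : 1 ≤ x := hw x (by simp)
    rw [List.foldl_append]
    set T := w.foldl heckeInsert empty with hTdef
    change _ ↔ m < (T.heckeInsert x).shape.rowLen 0 ∧ (T.heckeInsert x).entry (0, m) ≤ v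
    -- A subsequence either avoids the final `x`, or ends in it after `m` letters that are at most
    -- `x - 1`. The case `m = 0` is separate because the invariant only speaks of nonempty
    -- subsequences.
    have step : (∃ l : List ℕ, l.Sublist (w ++ [x]) ∧ l.Pairwise (· < ·) ∧ l.length = m + 1 ∧
        ∀ z ∈ l, z ≤ v) ↔ (m < T.shape.rowLen 0 ∧ T.entry (0, m) ≤ v) ∨
          (x ≤ v ∧ (m = 0 ∨ m - 1 < T.shape.rowLen 0 ∧ T.entry (0, m - 1) ≤ x - 1)) := by
      rw [← ih, ← ih]
      constructor
      · rintro ⟨l, hl, hd, hlen, hv⟩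
        obtain ⟨a, b, rfl, ha, hb⟩ := List.sublist_append_iff.1 hl
        rcases List.sublist_cons_iff.1 hb with hb | ⟨r, rfl, hr⟩
        · obtain rfl := List.sublist_nil.1 hb
          rw [List.append_nil] at hd hlen hv
          exact .inl ⟨a, ha, hd, hlen, hv⟩
        · obtain rfl := List.sublist_nil.1 hr
          refine .inr ⟨hv x (by simp), ?_⟩
          obtain ⟨hda, -, hab⟩ := List.pairwise_append.1 hd
          simp only [List.length_append, List.length_singleton] at hlen
          refine or_iff_not_imp_left.2 fun hm => ⟨a, ha, hda, by omega, fun z hz => ?_⟩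
          have := hab z hz x (by simp)
          omega
      · rintro (⟨l, hl, hd, hlen, hv⟩ | ⟨hxv, rfl | ⟨l, hl, hd, hlen, hv⟩⟩)
        · exact ⟨l, hl.trans (by simp), hd, hlen, hv⟩
        · exact ⟨[x], by simp, by simp, by simp, by simpa using hxv⟩
        · by_cases hm : m = 0
          · exact ⟨[x], by simp, by simp, by simp [hm], by simpa using hxv⟩
          · refine ⟨l ++ [x], hl.append (.refl _), ?_, by simp; omega, ?_⟩
            · refine List.pairwise_append.2 ⟨hd, by simp, fun a ha b hb => ?_⟩
              have := hv a ha
              obtain rfl : b = x := by simpa using hb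
              omega
            · intro z hz
              rcases List.mem_append.1 hz with h | h
              · have := hv z h
                omega
              · obtain rfl : z = x := by simpa using h
                exact hxv
    rw [step]
    obtain ⟨p, hp, hlt, hge, hlen, hent⟩ := T.heckeInsert_first_row hx
    rw [hlen, hent]
    split_ifs with hmp
    · subst hmp
      constructor
      · rintro (⟨h, h'⟩ | ⟨h, -⟩)
        · have := hge m le_rfl h
          exact ⟨.inr rfl, by omega⟩
        · exact ⟨.inr rfl, h⟩
      · rintro ⟨-, h⟩
        refine .inr ⟨h, or_iff_not_imp_left.2 fun hm => ⟨by omega, ?_⟩⟩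
        have := hlt (m - 1) (by omega)
        omega
    · constructor
      · rintro (⟨h, h'⟩ | ⟨h, h'⟩)
        · exact ⟨.inl h, h'⟩
        · have hmp' : m < p := by
            rcases h' with rfl | ⟨h₁, h₂⟩
            · omega
            · by_contra hc
              have := hge (m - 1) (by omega) h₁
              omega
          have := hlt m hmp'
          exact ⟨.inl (by omega), by omega⟩
      · rintro ⟨h | h, h'⟩
        · exact .inl ⟨h, h'⟩
        · exact absurd h hmp

end IncreasingTableau

/-! ### Subsequences given by positions -/

/-- A sublist of the word is the image of a sublist of the list of positions, which is increasing
and hence amounts to a set. -/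
theorem exists_sublist_ofFn_iff {n : ℕ} (f : Fin n → ℕ) (r : ℕ → ℕ → Prop) (m : ℕ) :
    (∃ l : List ℕ, l.Sublist (List.ofFn f) ∧ l.Pairwise r ∧ l.length = m) ↔
      ∃ s : Finset (Fin n), (∀ i ∈ s, ∀ j ∈ s, i < j → r (f i) (f j)) ∧ s.card = m := by
  rw [List.ofFn_eq_map]
  constructor
  · rintro ⟨l, hl, hr, rfl⟩
    obtain ⟨k, hk, rfl⟩ := List.sublist_map_iff.1 hl
    have hk' : k.Pairwise (· < ·) := (List.pairwise_lt_finRange n).sublist hk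
    have hnd : k.Nodup := hk'.imp fun h => h.ne
    refine ⟨k.toFinset, fun i hi j hj hij => ?_, ?_⟩
    · rw [List.pairwise_map] at hr
      have h := hr.and hk'
      rw [List.mem_toFinset] at hi hj
      obtain ⟨a, ha, rfl⟩ := List.getElem_of_mem hi
      obtain ⟨b, hb, rfl⟩ := List.getElem_of_mem hj
      have hab : a < b := by
        by_contra hc
        rcases (not_lt.1 hc).eq_or_lt with rfl | h'
        · exact lt_irrefl _ hij
        · exact lt_asymm hij (List.pairwise_iff_getElem.1 hk' b a hb ha h')
      exact List.pairwise_iff_getElem.1 hr a b ha hb hab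
    · rw [List.toFinset_card_of_nodup hnd, List.length_map]
  · rintro ⟨s, hs, rfl⟩
    refine ⟨((List.finRange n).filter (· ∈ s)).map f, List.filter_sublist.map f, ?_, ?_⟩
    · rw [List.pairwise_map]
      refine ((List.pairwise_lt_finRange n).sublist List.filter_sublist).imp_of_mem
        fun {a b} ha hb hab => hs a ?_ b ?_ hab
      · simpa using ha
      · simpa using hb
    · rw [List.length_map, ← List.toFinset_card_of_nodup
        ((List.nodup_finRange n).sublist List.filter_sublist)]
      congr 1
      ext i
      simp

theorem sup_card_eq {α : Type*} [Fintype α] [DecidableEq α] (p : Finset α → Prop)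
    [DecidablePred p] {m : ℕ} (hle : ∀ s, p s → s.card ≤ m) (hex : ∃ s, p s ∧ s.card = m) :
    ((Finset.univ : Finset (Finset α)).filter p).sup Finset.card = m := by
  refine le_antisymm (Finset.sup_le fun s hs => hle s (Finset.mem_filter.1 hs).2) ?_
  obtain ⟨s, hs, rfl⟩ := hex
  exact Finset.le_sup (f := Finset.card) (Finset.mem_filter.2 ⟨Finset.mem_univ s, hs⟩)

/-! ### The two equalities for words -/

theorem one_le_of_mem_ofFn {n q : ℕ} (w : Word n q) :
    ∀ x ∈ List.ofFn (fun k => (w k : ℕ)), 1 ≤ x := by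
  intro x hx
  obtain ⟨k, rfl⟩ := (List.mem_ofFn' _ _).1 hx
  exact (w k).2.1

theorem rowLen_heckeShape {n q : ℕ} (w : Word n q) : (heckeShape w).rowLen 0 = LIS w := by
  have hw := one_le_of_mem_ofFn w
  have key := IncreasingTableau.exists_increasing_sublist_iff _ hw
  have hbij := exists_sublist_ofFn_iff (fun k => (w k : ℕ)) (· < ·)
  refine (sup_card_eq _ (fun s hs => ?_) ?_).symm
  · obtain ⟨l, hl, hd, hlen⟩ := (hbij s.card).2 ⟨s, hs, rfl⟩
    rcases Nat.eq_zero_or_pos s.card with h | h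
    · omega
    -- The sum serves merely as some upper bound for all letters of `l`.
    · have := ((key (s.card - 1) l.sum).1 ⟨l, hl, hd, by omega,
        fun z hz => List.le_sum_of_mem hz⟩).1
      change _ ≤ (insertionTableau w).shape.rowLen 0
      rw [insertionTableau]
      omega
  · rcases Nat.eq_zero_or_pos ((heckeShape w).rowLen 0) with h | h
    · exact ⟨∅, by simp, by simp [h]⟩
    · obtain ⟨l, hl, hd, hlen, -⟩ := (key ((heckeShape w).rowLen 0 - 1) _).2
        ⟨show _ < (heckeShape w).rowLen 0 by omega, le_rfl⟩
      exact (hbij _).1 ⟨l, hl, hd, by omega⟩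

theorem colLen_heckeShape {n q : ℕ} (w : Word n q) : (heckeShape w).colLen 0 = LDS w := by
  have hw := one_le_of_mem_ofFn w
  obtain ⟨N, hN⟩ := IncreasingTableau.exists_foldl_decEquiv _ hw
  have hbij := exists_sublist_ofFn_iff (fun k => (w k : ℕ)) (· > ·)
  have h := hN (max N ((heckeShape w).colLen 0)) (le_max_left _ _)
  have hle : ∀ l : List ℕ, l.Sublist (List.ofFn fun k => (w k : ℕ)) → l.Pairwise (· > ·) →
      l.length ≤ (heckeShape w).colLen 0 := by
    intro l hl hd
    obtain ⟨l', hl', hd', hlen, -⟩ := h.2 l hl hd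
    exact hlen.trans (IncreasingTableau.length_le_of_sublist_rowsBelow _ hl' hd')
  refine (sup_card_eq _ (fun s hs => ?_) ?_).symm
  · obtain ⟨l, hl, hd, hlen⟩ := (hbij s.card).2 ⟨s, hs, rfl⟩
    exact hlen ▸ hle l hl hd
  · obtain ⟨l, hl, hd, hlen⟩ := (insertionTableau w).exists_sublist_rowsBelow
      (le_max_right N ((heckeShape w).colLen 0))
    obtain ⟨l', hl', hd', hlen', -⟩ := h.1 l hl hd
    exact (hbij _).1 ⟨l', hl', hd', le_antisymm (hle l' hl' hd') (hlen ▸ hlen')⟩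

end HeckeInsertion

theorem theorem1p3 (n q : ℕ) (w : HeckeInsertion.Word n q) :
    (HeckeInsertion.heckeShape w).rowLen 0 = HeckeInsertion.LIS w ∧
      (HeckeInsertion.heckeShape w).colLen 0 = HeckeInsertion.LDS w :=
  ⟨HeckeInsertion.rowLen_heckeShape w, HeckeInsertion.colLen_heckeShape w⟩
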